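/- Let $I=[0,1]$. Let $\widehat{U}$ be the monoid, under composition, of continuous monotone maps $I\to I$ fixing $1$, ordered pointwise. It has finite meets, computed pointwise, with greatest element the constant map $1$. A *continuous lattice* is a complete lattice $X$ in which every element $x$ is the join of the elements way below it. Here $y\ll x$ means: whenever $D\subseteq X$ is a nonempty directed set with $x\le\bigvee D$, some $d\in D$ satisfies $y\le d$. A morphism of continuous lattices is a map preserving arbitrary meets and (nonempty) directed joins. A *$\widehat{U}$-module* is a meet-semilattice $A$ with a greatest element $\top$ and an action of the monoid $\widehat{U}$ preserving finite meets in both variables: $u(a\wedge b)=u(a)\wedge u(b)$, $u(\top)=\top$, $(u\wedge v)(a)=u(a)\wedge v(a)$, and $1(a)=\top$ for the constant map $1\in\widehat{U}$. A morphism of $\widehat{U}$-modules is an equivariant map preserving finite meets, including $\top$. For $r\in I$ write $b\dotplus r$ for the result of the action on $b$ of the map $t\mapsto\min(1,t+r)$ in $\widehat{U}$, and put $$\rho(a,b)=\inf\{r\in I\mid a\le b\dotplus r\},\qquad \operatorname{dist}(a,b)=\max(\rho(a,b),\rho(b,a)).$$ The module $A$ is *Archimedean* if $\rho(a,b)=0$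 implies $a\le b$. It is *complete* if it is Archimedean and every sequence that is Cauchy for $\operatorname{dist}$ converges for $\operatorname{dist}$. The interval $I$ is both a continuous lattice and a complete $\widehat{U}$-module (under evaluation). **Theorem.** Hom into $I$ yields a dual equivalence of categories between continuous lattices and complete $\widehat{U}$-modules. Precisely: for a continuous lattice $X$, the set $\operatorname{Hom}(X,I)$ of continuous lattice morphisms, with the pointwise order and $\widehat{U}$ acting by postcomposition, is a complete $\widehat{U}$-module. For a complete $\widehat{U}$-module $A$, the set $\operatorname{Hom}(A,I)$ of $\widehat{U}$-module morphisms, with the pointwise order, is a continuous lattice. With precomposition on morphisms, these two contravariant hom functors form a dual adjunction whose (co)units are the evaluation morphisms $X\to\operatorname{Hom}(\operatorname{Hom}(X,I),I)$, $x\mapsto(f\mapsto f(x))$, and $A\to\operatorname{Hom}(\operatorname{Hom}(A,I),I)$, $a\mapsto(f\mapsto f(a))$. Both functors are equivalences of categories, that is, this dual adjunction is a dual equivalence. -/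

import Mathlib

open CategoryTheory Opposite unitInterval

universe u v w

namespace CtsDuality

/-! ### The unit interval -/

/-- Truncated addition `r ∔ s = min 1 (r + s)` on the unit interval. -/
noncomputable def tadd (r s : I) : I :=
  ⟨min 1 ((r : ℝ) + s), le_min zero_le_one (add_nonneg r.2.1 s.2.1), min_le_left _ _⟩

theorem le_tadd_iff (a r s : I) : a ≤ tadd r s ↔ (a : ℝ) ≤ r + s := by
  rw [← Subtype.coe_le_coe]
  simp only [tadd, le_min_iff, a.2.2, true_and]

/-! ### The monoid `Û` -/

/-- `Û`: the continuous monotone self-maps of the unit interval that fix `1`. -/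
@[ext]
structure UHat where
  toFun : I → I
  monotone' : Monotone toFun
  continuous' : Continuous toFun
  map_one' : toFun 1 = 1

namespace UHat

instance : FunLike UHat I I where
  coe := toFun
  coe_injective u v h := by cases u; cases v; congr

theorem hom_ext {p q : UHat} (h : ∀ r, p r = q r) : p = q := DFunLike.ext _ _ h

/-- Multiplication in `Û` is composition. -/
instance : Monoid UHat where
  mul p q := ⟨fun r => p (q r), p.monotone'.comp q.monotone',
    p.continuous'.comp q.continuous', by
      rw [show q 1 = 1 from q.map_one', show p 1 = 1 from p.map_one']⟩
  one := ⟨id, monotone_id, continuous_id, rfl⟩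
  mul_assoc _ _ _ := rfl
  one_mul _ := rfl
  mul_one _ := rfl

/-- The order on `Û` is pointwise. -/
instance : PartialOrder UHat where
  le p q := ∀ r, p r ≤ q r
  le_refl _ _ := le_rfl
  le_trans _ _ _ h k r := (h r).trans (k r)
  le_antisymm _ _ h k := hom_ext fun r => le_antisymm (h r) (k r)

/-- Binary meets in `Û` are pointwise. -/
instance : SemilatticeInf UHat where
  inf p q := ⟨fun r => p r ⊓ q r, fun _ _ h => inf_le_inf (p.monotone' h) (q.monotone' h),
    p.continuous'.min q.continuous', by
      rw [show q 1 = 1 from q.map_one', show p 1 = 1 from p.map_one', inf_idem]⟩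
  inf_le_left _ _ _ := inf_le_left
  inf_le_right _ _ _ := inf_le_right
  le_inf _ _ _ h k r := le_inf (h r) (k r)

/-- The greatest element of `Û` is the constant map `1`. -/
instance : OrderTop UHat where
  top := ⟨fun _ => 1, monotone_const, continuous_const, rfl⟩
  le_top _ _ := le_one'

/-- The element `(-) ∔ r` of `Û`. -/
noncomputable def shift (r : I) : UHat where
  toFun a := tadd a r
  monotone' a b h := by
    rw [le_tadd_iff]
    have h' : (a : ℝ) ≤ b := h
    simp only [tadd]
    exact (min_le_right _ _).trans (by linarith)
  continuous' := by unfold tadd; fun_prop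
  map_one' := by
    apply Subtype.ext
    simp [tadd, r.2.1]

theorem map_sInf (p : UHat) (S : Set I) : p (sInf S) = sInf (p '' S) :=
  p.monotone'.map_sInf_of_continuousAt p.continuous'.continuousAt p.map_one'

theorem map_sSup (p : UHat) (S : Set I) (hS : S.Nonempty) : p (sSup S) = sSup (p '' S) :=
  p.monotone'.map_csSup_of_continuousAt p.continuous'.continuousAt hS

end UHat

/-! ### `Û`-modules -/

/-- A `Û`-module: a meet-semilattice with greatest element, together with an action of the
monoid `Û` that preserves finite meets (binary meets and the greatest element) in each of its
two variables. -/
class UModule (A : Type u) [SemilatticeInf A] [OrderTop A] extends MulAction UHat A where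
  smul_inf : ∀ (p : UHat) (a b : A), p • (a ⊓ b) = p • a ⊓ p • b
  smul_top : ∀ p : UHat, p • (⊤ : A) = ⊤
  inf_smul : ∀ (p q : UHat) (a : A), (p ⊓ q) • a = p • a ⊓ q • a
  top_smul : ∀ a : A, (⊤ : UHat) • a = ⊤

section UModule

variable {A : Type u} [SemilatticeInf A] [OrderTop A] [UModule A]

/-- `ρ(a, b) = ⋀ {r ∈ [0,1] | a ≤ b ∔ r}`. -/
noncomputable def rho (a b : A) : I := sInf {r : I | a ≤ UHat.shift r • b}

/-- `dist(a, b) = ρ(a, b) ∨ ρ(b, a)`. -/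
noncomputable def udist (a b : A) : I := rho a b ⊔ rho b a

variable (A)

/-- `A` is Archimedean: `ρ(a, b) = 0` implies `a ≤ b`. -/
def IsArchimedean : Prop := ∀ a b : A, rho a b = 0 → a ≤ b

/-- `A` is complete: it is Archimedean, and every sequence in `A` which is Cauchy for `dist`
converges for `dist`. -/
def IsComplete : Prop :=
  IsArchimedean A ∧
    ∀ s : ℕ → A,
      (∀ ε : ℝ, 0 < ε → ∃ N, ∀ m ≥ N, ∀ n ≥ N, (udist (s m) (s n) : ℝ) < ε) →
      ∃ a : A, ∀ ε : ℝ, 0 < ε → ∃ N, ∀ n ≥ N, (udist (s n) a : ℝ) < ε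

end UModule

/-- A morphism of `Û`-modules: a `Û`-equivariant map that preserves finite meets. -/
structure UModHom (A : Type u) (B : Type v) [SemilatticeInf A] [OrderTop A] [UModule A]
    [SemilatticeInf B] [OrderTop B] [UModule B] where
  toFun : A → B
  map_inf' : ∀ a b, toFun (a ⊓ b) = toFun a ⊓ toFun b
  map_top' : toFun ⊤ = ⊤
  map_smul' : ∀ (p : UHat) (a : A), toFun (p • a) = p • toFun a

instance (A : Type u) (B : Type v) [SemilatticeInf A] [OrderTop A] [UModule A]
    [SemilatticeInf B] [OrderTop B] [UModule B] : FunLike (UModHom A B) A B where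
  coe := UModHom.toFun
  coe_injective u v h := by cases u; cases v; congr

/-- The unit interval is a `Û`-module, under evaluation. -/
instance : UModule I where
  smul p r := p r
  one_smul _ := rfl
  mul_smul _ _ _ := rfl
  smul_inf p _ _ := p.monotone'.map_inf _ _
  smul_top p := p.map_one'
  inf_smul _ _ _ := rfl
  top_smul _ := rfl

/-! ### Continuous lattices -/

/-- The way-below relation `y ≪ x` in a complete lattice. -/
def WayBelow {X : Type u} [CompleteLattice X] (y x : X) : Prop :=
  ∀ D : Set X, D.Nonempty → DirectedOn (· ≤ ·) D → x ≤ sSup D → ∃ d ∈ D, y ≤ d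

/-- A continuous lattice: a complete lattice in which every element is the join of the elements
way below it (these always form a directed set, being closed under finite joins). -/
class IsContinuousLattice (X : Type u) [CompleteLattice X] : Prop where
  sSup_wayBelow : ∀ x : X, sSup {y | WayBelow y x} = x

/-- A morphism of continuous lattices: a map preserving arbitrary meets and directed joins. -/
structure CtsLatHom (X : Type u) (Y : Type v) [CompleteLattice X] [CompleteLattice Y] where
  toFun : X → Y
  map_sInf' : ∀ S : Set X, toFun (sInf S) = sInf (toFun '' S)
  map_sSup' : ∀ D : Set X, D.Nonempty → DirectedOn (· ≤ ·) D → toFun (sSup D) = sSup (toFun '' D)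

instance (X : Type u) (Y : Type v) [CompleteLattice X] [CompleteLattice Y] :
    FunLike (CtsLatHom X Y) X Y where
  coe := CtsLatHom.toFun
  coe_injective u v h := by cases u; cases v; congr

/-! ### The dual of a continuous lattice -/

namespace CtsLatHom

section Basic

variable {X : Type u} {Y : Type v} {Z : Type w} [CompleteLattice X] [CompleteLattice Y]
  [CompleteLattice Z]

theorem hom_ext {f g : CtsLatHom X Y} (h : ∀ x, f x = g x) : f = g := DFunLike.ext _ _ h

theorem map_sInf (f : CtsLatHom X Y) (S : Set X) : f (sInf S) = sInf (f '' S) := f.map_sInf' S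

theorem map_sSup (f : CtsLatHom X Y) (D : Set X) (h : D.Nonempty) (h' : DirectedOn (· ≤ ·) D) :
    f (sSup D) = sSup (f '' D) := f.map_sSup' D h h'

theorem mono (f : CtsLatHom X Y) : Monotone f := fun a b h => by
  have h1 := f.map_sInf {a, b}
  rw [sInf_pair, inf_eq_left.mpr h, Set.image_pair, sInf_pair] at h1
  rw [h1]
  exact inf_le_right

/-- The identity morphism. -/
def id (X : Type u) [CompleteLattice X] : CtsLatHom X X where
  toFun x := x
  map_sInf' S := by simp
  map_sSup' S _ _ := by simp

/-- Composition of morphisms. -/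
def comp (g : CtsLatHom Y Z) (f : CtsLatHom X Y) : CtsLatHom X Z where
  toFun x := g (f x)
  map_sInf' S := by rw [f.map_sInf, g.map_sInf, Set.image_image]
  map_sSup' D h h' := by
    rw [f.map_sSup D h h', g.map_sSup _ (h.image _), Set.image_image]
    rintro _ ⟨a, ha, rfl⟩ _ ⟨b, hb, rfl⟩
    obtain ⟨c, hc, hac, hbc⟩ := h' a ha b hb
    exact ⟨f c, ⟨c, hc, rfl⟩, f.mono hac, f.mono hbc⟩

end Basic

variable {X : Type u} [CompleteLattice X]

/-- Morphisms into the unit interval are ordered pointwise. -/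
instance : PartialOrder (CtsLatHom X I) where
  le f g := ∀ x, f x ≤ g x
  le_refl _ _ := le_rfl
  le_trans _ _ _ h k r := (h r).trans (k r)
  le_antisymm _ _ h k := hom_ext fun r => le_antisymm (h r) (k r)

/-- Binary meets of morphisms into the unit interval are pointwise. -/
noncomputable instance : SemilatticeInf (CtsLatHom X I) where
  inf f g :=
    { toFun := fun x => f x ⊓ g x
      map_sInf' := fun S => by
        rw [f.map_sInf, g.map_sInf]
        apply le_antisymm
        · refine le_sInf ?_
          rintro _ ⟨x, hx, rfl⟩
          exact inf_le_inf (sInf_le (Set.mem_image_of_mem _ hx)) (sInf_le (Set.mem_image_of_mem _ hx))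
        · refine le_inf (le_sInf ?_) (le_sInf ?_)
          · rintro _ ⟨x, hx, rfl⟩
            exact (sInf_le (Set.mem_image_of_mem _ hx)).trans inf_le_left
          · rintro _ ⟨x, hx, rfl⟩
            exact (sInf_le (Set.mem_image_of_mem _ hx)).trans inf_le_right
      map_sSup' := fun D h h' => by
        apply le_antisymm
        · rw [f.map_sSup D h h', g.map_sSup D h h']
          refine le_of_forall_lt fun c hc => ?_
          obtain ⟨h1, h2⟩ := lt_inf_iff.mp hc
          obtain ⟨_, ⟨x, hx, rfl⟩, h1⟩ := lt_sSup_iff.mp h1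
          obtain ⟨_, ⟨y, hy, rfl⟩, h2⟩ := lt_sSup_iff.mp h2
          obtain ⟨z, hz, hxz, hyz⟩ := h' x hx y hy
          exact lt_of_lt_of_le (lt_inf_iff.mpr ⟨h1.trans_le (f.mono hxz), h2.trans_le (g.mono hyz)⟩)
            (le_sSup ⟨z, hz, rfl⟩)
        · refine sSup_le ?_
          rintro _ ⟨x, hx, rfl⟩
          exact inf_le_inf (f.mono (le_sSup hx)) (g.mono (le_sSup hx)) }
  inf_le_left _ _ _ := inf_le_left
  inf_le_right _ _ _ := inf_le_right
  le_inf _ _ _ h k r := le_inf (h r) (k r)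

/-- The greatest morphism into the unit interval is the constant map `1`. -/
noncomputable instance : OrderTop (CtsLatHom X I) where
  top :=
    { toFun := fun _ => 1
      map_sInf' := fun S => by
        symm
        refine top_le_iff.mp (le_sInf ?_)
        rintro _ ⟨x, -, rfl⟩
        exact le_rfl
      map_sSup' := fun D h _ => by rw [h.image_const, sSup_singleton] }
  le_top _ _ := le_one'

/-- `Û` acts on morphisms into the unit interval by postcomposition. -/
noncomputable instance : UModule (CtsLatHom X I) where
  smul p f :=
    { toFun := fun x => p (f x)
      map_sInf' := fun S => by rw [f.map_sInf, p.map_sInf, Set.image_image]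
      map_sSup' := fun D h h' => by
        rw [f.map_sSup D h h', p.map_sSup _ (h.image _), Set.image_image] }
  one_smul _ := rfl
  mul_smul _ _ _ := rfl
  smul_inf p f g := hom_ext fun x => p.monotone'.map_inf (f x) (g x)
  smul_top p := hom_ext fun _ => p.map_one'
  inf_smul _ _ _ := rfl
  top_smul _ := rfl

theorem smul_apply (p : UHat) (f : CtsLatHom X I) (x : X) : (p • f) x = p (f x) := rfl

theorem le_shift_iff (f g : CtsLatHom X I) (r : I) :
    f ≤ UHat.shift r • g ↔ ∀ x, (f x : ℝ) ≤ g x + r :=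
  forall_congr' fun x => le_tadd_iff (f x) (g x) r

theorem le_add_of_rho_lt {f g : CtsLatHom X I} {ε : ℝ} (h : (rho f g : ℝ) < ε) (x : X) :
    (f x : ℝ) ≤ g x + ε := by
  by_contra hx
  push Not at hx
  have hε : (0 : ℝ) ≤ ε := (rho f g).2.1.trans h.le
  have hε1 : ε ≤ 1 := by linarith [(f x).2.2, (g x).2.1]
  have h' : rho f g < (⟨ε, hε, hε1⟩ : I) := h
  obtain ⟨r, hr, hrε⟩ := sInf_lt_iff.mp h'
  have h1 := (le_shift_iff f g r).mp hr x
  have h2 : (r : ℝ) < ε := hrε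
  linarith

theorem rho_le {f g : CtsLatHom X I} {ε : ℝ} (hε : 0 ≤ ε) (h : ∀ x, (f x : ℝ) ≤ g x + ε) :
    (rho f g : ℝ) ≤ ε := by
  rcases le_total ε 1 with hε1 | hε1
  · exact (sInf_le ((le_shift_iff f g ⟨ε, hε, hε1⟩).mpr h) : rho f g ≤ _)
  · exact (rho f g).2.2.trans hε1

theorem isArchimedean : IsArchimedean (CtsLatHom X I) := fun f g h x => by
  change (f x : ℝ) ≤ g x
  refine le_of_forall_pos_le_add fun ε hε => le_add_of_rho_lt ?_ x
  rw [h]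
  exact hε

/-- Uniform limits of morphisms are morphisms. -/
theorem exists_limit (s : ℕ → CtsLatHom X I) (L : X → I)
    (hL : ∀ ε : ℝ, 0 < ε → ∃ n, ∀ x, (s n x : ℝ) ≤ L x + ε ∧ (L x : ℝ) ≤ s n x + ε) :
    ∃ f : CtsLatHom X I, ∀ x, f x = L x := by
  have hmono : Monotone L := fun a b hab => by
    change (L a : ℝ) ≤ L b
    refine le_of_forall_pos_le_add fun ε hε => ?_
    obtain ⟨n, hn⟩ := hL (ε / 2) (by linarith)
    have h1 : (s n a : ℝ) ≤ s n b := (s n).mono hab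
    linarith [(hn a).2, (hn b).1]
  refine ⟨⟨L, fun S => le_antisymm ?_ ?_, fun D h h' => le_antisymm ?_ ?_⟩, fun _ => rfl⟩
  · refine le_sInf ?_
    rintro _ ⟨x, hx, rfl⟩
    exact hmono (sInf_le hx)
  · by_contra hlt
    have hlt' : (L (sInf S) : ℝ) < (sInf (L '' S) : I) := not_le.mp hlt
    obtain ⟨n, hn⟩ := hL (((sInf (L '' S) : I) - L (sInf S) : ℝ) / 3) (by linarith)
    set d : I := sInf (L '' S)
    set c : I := L (sInf S)
    have hc := c.2.1
    have hd := d.2.2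
    have h1 : (⟨d - (d - c) / 3, by linarith, by linarith⟩ : I) ≤ s n (sInf S) := by
      rw [(s n).map_sInf]
      refine le_sInf ?_
      rintro _ ⟨x, hx, rfl⟩
      have h2 : (d : ℝ) ≤ L x := (sInf_le ⟨x, hx, rfl⟩ : d ≤ L x)
      change (d - (d - c) / 3 : ℝ) ≤ s n x
      linarith [(hn x).2]
    have h1' : (d - (d - c) / 3 : ℝ) ≤ s n (sInf S) := h1
    linarith [(hn (sInf S)).1]
  · by_contra hlt
    have hlt' : ((sSup (L '' D) : I) : ℝ) < L (sSup D) := not_le.mp hlt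
    obtain ⟨n, hn⟩ := hL ((L (sSup D) - (sSup (L '' D) : I) : ℝ) / 3) (by linarith)
    set d : I := sSup (L '' D)
    set c : I := L (sSup D)
    have hc := c.2.2
    have hd := d.2.1
    have h1 : s n (sSup D) ≤ (⟨d + (c - d) / 3, by linarith, by linarith⟩ : I) := by
      rw [(s n).map_sSup D h h']
      refine sSup_le ?_
      rintro _ ⟨x, hx, rfl⟩
      have h2 : (L x : ℝ) ≤ d := (le_sSup ⟨x, hx, rfl⟩ : L x ≤ d)
      change (s n x : ℝ) ≤ (d + (c - d) / 3 : ℝ)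
      linarith [(hn x).1]
    have h1' : (s n (sSup D) : ℝ) ≤ (d + (c - d) / 3 : ℝ) := h1
    linarith [(hn (sSup D)).2]
  · refine sSup_le ?_
    rintro _ ⟨x, hx, rfl⟩
    exact hmono (le_sSup hx)

/-- The dual of a complete lattice is a complete `Û`-module. -/
theorem isComplete : IsComplete (CtsLatHom X I) := by
  refine ⟨isArchimedean, fun s hs => ?_⟩
  have key : ∀ ε : ℝ, 0 < ε → ∃ N, ∀ m ≥ N, ∀ n ≥ N, ∀ x, (s m x : ℝ) ≤ s n x + ε := by
    intro ε hε
    obtain ⟨N, hN⟩ := hs ε hε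
    refine ⟨N, fun m hm n hn => le_add_of_rho_lt (lt_of_le_of_lt ?_ (hN m hm n hn))⟩
    exact (le_sup_left : rho (s m) (s n) ≤ udist (s m) (s n))
  have hc : ∀ x, ∃ l : I, Filter.Tendsto (fun n => s n x) Filter.atTop (nhds l) := fun x => by
    refine cauchySeq_tendsto_of_complete (Metric.cauchySeq_iff.mpr fun ε hε => ?_)
    obtain ⟨N, hN⟩ := key (ε / 2) (by linarith)
    refine ⟨N, fun m hm n hn => ?_⟩
    rw [Subtype.dist_eq, Real.dist_eq, abs_lt]
    constructor <;> linarith [hN m hm n hn x, hN n hn m hm x]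
  choose L hL using hc
  have hL' : ∀ x, Filter.Tendsto (fun n => (s n x : ℝ)) Filter.atTop (nhds (L x : ℝ)) :=
    fun x => (continuous_subtype_val.tendsto _).comp (hL x)
  have unif : ∀ ε : ℝ, 0 < ε → ∃ N, ∀ n ≥ N, ∀ x,
      (s n x : ℝ) ≤ L x + ε ∧ (L x : ℝ) ≤ s n x + ε := by
    intro ε hε
    obtain ⟨N, hN⟩ := key ε hε
    refine ⟨N, fun n hn x => ⟨?_, ?_⟩⟩
    · refine ge_of_tendsto ((hL' x).add_const ε) ?_
      filter_upwards [Filter.eventually_ge_atTop N] with m hm using hN n hn m hm x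
    · refine le_of_tendsto (hL' x) ?_
      filter_upwards [Filter.eventually_ge_atTop N] with m hm using hN m hm n hn x
  obtain ⟨f, hf⟩ := exists_limit s L fun ε hε => by
    obtain ⟨N, hN⟩ := unif ε hε
    exact ⟨N, hN N le_rfl⟩
  refine ⟨f, fun ε hε => ?_⟩
  obtain ⟨N, hN⟩ := unif (ε / 2) (by linarith)
  refine ⟨N, fun n hn => lt_of_le_of_lt ?_ (by linarith : ε / 2 < ε)⟩
  have h1 : (rho (s n) f : ℝ) ≤ ε / 2 := rho_le (by linarith) fun x => by
    rw [hf]; exact (hN n hn x).1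
  have h2 : (rho f (s n) : ℝ) ≤ ε / 2 := rho_le (by linarith) fun x => by
    rw [hf]; exact (hN n hn x).2
  rcases le_total (rho (s n) f) (rho f (s n)) with h | h
  · rw [udist, sup_eq_right.mpr h]; exact h2
  · rw [udist, sup_eq_left.mpr h]; exact h1

end CtsLatHom

/-! ### The dual of a `Û`-module -/

namespace UModHom

section Basic

variable {A : Type u} {B : Type v} {C : Type w} [SemilatticeInf A] [OrderTop A] [UModule A]
  [SemilatticeInf B] [OrderTop B] [UModule B] [SemilatticeInf C] [OrderTop C] [UModule C]

theorem hom_ext {f g : UModHom A B} (h : ∀ x, f x = g x) : f = g := DFunLike.ext _ _ h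

theorem map_inf (f : UModHom A B) (a b : A) : f (a ⊓ b) = f a ⊓ f b := f.map_inf' a b

theorem map_top (f : UModHom A B) : f ⊤ = ⊤ := f.map_top'

theorem map_smul (f : UModHom A B) (p : UHat) (a : A) : f (p • a) = p • f a := f.map_smul' p a

/-- The identity morphism. -/
def id (A : Type u) [SemilatticeInf A] [OrderTop A] [UModule A] : UModHom A A where
  toFun a := a
  map_inf' _ _ := rfl
  map_top' := rfl
  map_smul' _ _ := rfl

/-- Composition of morphisms. -/
def comp (g : UModHom B C) (f : UModHom A B) : UModHom A C where
  toFun a := g (f a)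
  map_inf' a b := by rw [f.map_inf, g.map_inf]
  map_top' := by rw [f.map_top, g.map_top]
  map_smul' p a := by rw [f.map_smul, g.map_smul]

end Basic

variable {A : Type u} [SemilatticeInf A] [OrderTop A] [UModule A]

theorem smul_apply (f : UModHom A I) (p : UHat) (a : A) : f (p • a) = p (f a) := f.map_smul p a

/-- Morphisms into the unit interval are ordered pointwise. -/
instance : PartialOrder (UModHom A I) where
  le f g := ∀ x, f x ≤ g x
  le_refl _ _ := le_rfl
  le_trans _ _ _ h k r := (h r).trans (k r)
  le_antisymm _ _ h k := hom_ext fun r => le_antisymm (h r) (k r)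

/-- Arbitrary meets of morphisms into the unit interval are pointwise. -/
noncomputable instance : InfSet (UModHom A I) where
  sInf S :=
    { toFun := fun a => sInf ((fun f : UModHom A I => f a) '' S)
      map_inf' := fun a b => by
        apply le_antisymm
        · refine le_inf (le_sInf ?_) (le_sInf ?_)
          · rintro _ ⟨f, hf, rfl⟩
            exact (sInf_le (Set.mem_image_of_mem _ hf)).trans ((f.map_inf a b).trans_le inf_le_left)
          · rintro _ ⟨f, hf, rfl⟩
            exact (sInf_le (Set.mem_image_of_mem _ hf)).trans ((f.map_inf a b).trans_le inf_le_right)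
        · refine le_sInf ?_
          rintro _ ⟨f, hf, rfl⟩
          exact (inf_le_inf (sInf_le (Set.mem_image_of_mem _ hf)) (sInf_le (Set.mem_image_of_mem _ hf))).trans_eq
            (f.map_inf a b).symm
      map_top' := by
        refine top_le_iff.mp (le_sInf ?_)
        rintro _ ⟨f, hf, rfl⟩
        exact f.map_top.ge
      map_smul' := fun p a => by
        change _ = p _
        rw [p.map_sInf, Set.image_image]
        congr 1
        exact Set.image_congr fun f _ => f.smul_apply p a }

theorem sInf_apply (S : Set (UModHom A I)) (a : A) :
    (sInf S) a = sInf ((fun f : UModHom A I => f a) '' S) := rfl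

noncomputable instance : CompleteLattice (UModHom A I) :=
  completeLatticeOfInf _ fun S =>
    ⟨fun f hf a => by
      rw [sInf_apply]
      exact sInf_le (Set.mem_image_of_mem _ hf),
    fun g hg a => le_sInf <| by
      rintro _ ⟨f, hf, rfl⟩
      exact hg hf a⟩

/-- Directed joins of morphisms into the unit interval are pointwise. -/
theorem sSup_apply (D : Set (UModHom A I)) (h : D.Nonempty) (h' : DirectedOn (· ≤ ·) D) (a : A) :
    (sSup D) a = sSup ((fun f : UModHom A I => f a) '' D) := by
  let g : UModHom A I :=
    { toFun := fun a => sSup ((fun f : UModHom A I => f a) '' D)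
      map_inf' := fun a b => by
        apply le_antisymm
        · refine sSup_le ?_
          rintro _ ⟨f, hf, rfl⟩
          exact (f.map_inf a b).trans_le
            (inf_le_inf (le_sSup (Set.mem_image_of_mem _ hf)) (le_sSup (Set.mem_image_of_mem _ hf)))
        · refine le_of_forall_lt fun c hc => ?_
          obtain ⟨h1, h2⟩ := lt_inf_iff.mp hc
          obtain ⟨_, ⟨f, hf, rfl⟩, h1⟩ := lt_sSup_iff.mp h1
          obtain ⟨_, ⟨g, hg, rfl⟩, h2⟩ := lt_sSup_iff.mp h2
          obtain ⟨k, hk, hfk, hgk⟩ := h' f hf g hg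
          refine lt_of_lt_of_le (lt_inf_iff.mpr ⟨h1.trans_le (hfk a), h2.trans_le (hgk b)⟩) ?_
          exact (k.map_inf a b).symm.trans_le (le_sSup (Set.mem_image_of_mem _ hk))
      map_top' := by
        obtain ⟨f, hf⟩ := h
        exact top_le_iff.mp (f.map_top.symm.trans_le (le_sSup (Set.mem_image_of_mem _ hf)))
      map_smul' := fun p a => by
        change _ = p _
        rw [p.map_sSup _ (h.image _), Set.image_image]
        congr 1
        exact Set.image_congr fun f _ => f.smul_apply p a }
  have hg : sSup D = g := by
    apply le_antisymm
    · exact sSup_le fun f hf a => le_sSup ⟨f, hf, rfl⟩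
    · intro a
      refine sSup_le ?_
      rintro _ ⟨f, hf, rfl⟩
      exact (le_sSup hf : f ≤ sSup D) a
  rw [hg]
  rfl

/-- The dual of a `Û`-module is a continuous lattice. -/
instance : IsContinuousLattice (UModHom A I) where
  sSup_wayBelow f := by
    apply le_antisymm
    · refine sSup_le fun g hg => ?_
      obtain ⟨d, hd, h⟩ := hg {f} (Set.singleton_nonempty f)
        (by simp [DirectedOn]) (by simp)
      rw [Set.mem_singleton_iff] at hd
      exact hd ▸ h
    · intro a
      refine le_of_forall_lt_imp_le_of_dense fun r hr => ?_
      have hway : WayBelow (sInf {g : UModHom A I | r ≤ g a}) f := fun D h h' hf => by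
        have h1 : r < sSup ((fun f : UModHom A I => f a) '' D) := by
          rw [← sSup_apply D h h']
          exact hr.trans_le (hf a)
        obtain ⟨_, ⟨d, hd, rfl⟩, h1⟩ := lt_sSup_iff.mp h1
        exact ⟨d, hd, sInf_le (show r ≤ d a from h1.le)⟩
      have h2 : sInf {g : UModHom A I | r ≤ g a} ≤ sSup {y | WayBelow y f} := le_sSup hway
      refine le_trans ?_ (h2 a)
      rw [sInf_apply]
      refine le_sInf ?_
      rintro _ ⟨g, hg, rfl⟩
      exact hg

end UModHom

/-! ### Evaluation morphisms into the double duals -/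

/-- The evaluation morphism `A → Hom(Hom(A, [0,1]), [0,1])`, `a ↦ (f ↦ f a)`. -/
noncomputable def UModHom.eval (A : Type u) [SemilatticeInf A] [OrderTop A] [UModule A] :
    UModHom A (CtsLatHom (UModHom A I) I) where
  toFun a :=
    { toFun := fun f => f a
      map_sInf' := fun _ => rfl
      map_sSup' := fun D hD hD' => UModHom.sSup_apply D hD hD' a }
  map_inf' a b := CtsLatHom.hom_ext fun f => f.map_inf a b
  map_top' := CtsLatHom.hom_ext fun f => f.map_top
  map_smul' p a := CtsLatHom.hom_ext fun f => f.map_smul p a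

/-- The evaluation morphism `X → Hom(Hom(X, [0,1]), [0,1])`, `x ↦ (f ↦ f x)`. -/
noncomputable def CtsLatHom.eval (X : Type u) [CompleteLattice X] :
    CtsLatHom X (UModHom (CtsLatHom X I) I) where
  toFun x :=
    { toFun := fun f => f x
      map_inf' := fun _ _ => rfl
      map_top' := rfl
      map_smul' := fun _ _ => rfl }
  map_sInf' S := UModHom.hom_ext fun f => by
    rw [UModHom.sInf_apply, Set.image_image]
    exact f.map_sInf S
  map_sSup' D hD hD' := UModHom.hom_ext fun f => by
    rw [UModHom.sSup_apply _ (hD.image _), Set.image_image]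
    · exact f.map_sSup D hD hD'
    · rintro _ ⟨a, ha, rfl⟩ _ ⟨b, hb, rfl⟩
      obtain ⟨c, hc, hac, hbc⟩ := hD' a ha b hb
      exact ⟨_, ⟨c, hc, rfl⟩, fun g => g.mono hac, fun g => g.mono hbc⟩

/-! ### The two categories and the two hom functors -/

/-- The category of continuous lattices. -/
structure CtsLat where
  carrier : Type u
  [completeLattice : CompleteLattice carrier]
  [isContinuousLattice : IsContinuousLattice carrier]

namespace CtsLat

instance : CoeSort CtsLat.{u} (Type u) := ⟨carrier⟩

attribute [instance] completeLattice isContinuousLattice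

instance : Category CtsLat.{u} where
  Hom X Y := CtsLatHom X Y
  id X := CtsLatHom.id X
  comp f g := CtsLatHom.comp g f

end CtsLat

/-- The category of complete `Û`-modules, a full subcategory of that of `Û`-modules. -/
structure CompleteUMod where
  carrier : Type u
  [semilatticeInf : SemilatticeInf carrier]
  [orderTop : OrderTop carrier]
  [uModule : UModule carrier]
  isComplete : IsComplete carrier

namespace CompleteUMod

instance : CoeSort CompleteUMod.{u} (Type u) := ⟨carrier⟩

attribute [instance] semilatticeInf orderTop uModule

instance : Category CompleteUMod.{u} where
  Hom A B := UModHom A B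
  id A := UModHom.id A
  comp f g := UModHom.comp g f

end CompleteUMod

/-- The contravariant functor `X ↦ Hom(X, [0,1])` from continuous lattices to complete
`Û`-modules, with pointwise structure on the hom set and precomposition on morphisms. -/
noncomputable def dualOfCtsLat : CtsLat.{u}ᵒᵖ ⥤ CompleteUMod.{u} where
  obj X := { carrier := CtsLatHom X.unop I, isComplete := CtsLatHom.isComplete }
  map {X Y} h :=
    { toFun := fun f : CtsLatHom X.unop I => f.comp (h.unop : CtsLatHom Y.unop X.unop)
      map_inf' := fun _ _ => rfl
      map_top' := rfl
      map_smul' := fun _ _ => rfl }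

/-- The contravariant functor `A ↦ Hom(A, [0,1])` from complete `Û`-modules to continuous
lattices, with pointwise order on the hom set and precomposition on morphisms. -/
noncomputable def dualOfUMod : CompleteUMod.{u}ᵒᵖ ⥤ CtsLat.{u} where
  obj A := { carrier := UModHom A.unop I }
  map {A B} h :=
    { toFun := fun f : UModHom A.unop I => f.comp (h.unop : UModHom B.unop A.unop)
      map_sInf' := fun S => UModHom.hom_ext fun b => by
        rw [UModHom.sInf_apply, Set.image_image]
        rfl
      map_sSup' := fun D hD hD' => UModHom.hom_ext fun b => by
        rw [UModHom.sSup_apply _ (hD.image _), Set.image_image]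
        · exact UModHom.sSup_apply D hD hD' _
        · rintro _ ⟨f, hf, rfl⟩ _ ⟨g, hg, rfl⟩
          obtain ⟨k, hk, hfk, hgk⟩ := hD' f hf g hg
          exact ⟨_, ⟨k, hk, rfl⟩, fun x => hfk _, fun x => hgk _⟩ }

/-- The evaluation morphism `A ⟶ Hom(Hom(A, [0,1]), [0,1])`, `a ↦ (f ↦ f a)`, as a morphism of
the category of complete `Û`-modules. -/
noncomputable def evalUMod (A : CompleteUMod.{u}) :
    A ⟶ dualOfCtsLat.obj (op (dualOfUMod.obj (op A))) :=
  UModHom.eval A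

/-- The evaluation morphism `X ⟶ Hom(Hom(X, [0,1]), [0,1])`, `x ↦ (f ↦ f x)`, as a morphism of
the category of continuous lattices. -/
noncomputable def evalCtsLat (X : CtsLat.{u}) :
    X ⟶ dualOfUMod.obj (op (dualOfCtsLat.obj (op X))) :=
  CtsLatHom.eval X

end CtsDuality

namespace CtsDuality

/-! ### Elements of `Û` used to cut values off. -/

namespace UHat

/-! The triangle identities for the evaluations hold definitionally, and a bijective morphism is
invertible in either category, so the theorem reduces to the bijectivity of both evaluations. Each
half combines a Urysohn-type separation with a reconstruction from directed joins.

Injectivity on an Archimedean module (`le_of_forall_hom_le`): if `p r = 1`, `q t = 0` and `p • a ≤ q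
• b`, then every morphism `f` with `r ≤ f a` has `t < f b`. Conversely, these relations define a
morphism, `forcingHom a r`, so all order information seen by morphisms comes from such inequalities.
If `f a ≤ f b` for all `f`, the inequalities with `r = (k + 1) / N` and `t = k / N` combine into `a
≤ b ∔ ε` whenever `2 / N < ε`, and the Archimedean property finishes.

Surjectivity on a complete module (`eval_surjective`): since a morphism `F` on the dual preserves
meets and directed joins, its level sets are separated by elements of the module
(`exists_interpolating_element`). Finite meets of truncations of these approximate `F` uniformly,
and completeness gives a limit.

Injectivity on a continuous lattice (`WayBelow.exists_hom`): way-below interpolates, so `a ≪ b`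
extends to a dyadic scale, as in Urysohn's lemma, and the scale defines a morphism separating
points.

Surjectivity on a complete lattice (`CtsLatHom.eval_surjective`): `Φ` is evaluation at the directed
join, over all `g` with `Φ g = 1`, of the least point where `g` is at least `1 / 2`. -/

theorem mono (p : UHat) : Monotone p := p.monotone'

theorem map_one (p : UHat) : p 1 = 1 := p.map_one'

theorem mul_apply (p q : UHat) (x : I) : (p * q) x = p (q x) := rfl

/-- The piecewise linear map which vanishes up to `p` and is `1` from `q` on. -/
noncomputable def ramp (p q : I) (h : p < q) : UHat where
  toFun x := Set.projIcc 0 1 zero_le_one (((x : ℝ) - p) / (q - p))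
  monotone' x y hxy := Set.monotone_projIcc _ <| by
    have h1 : (p : ℝ) < q := h
    have h2 : (x : ℝ) ≤ y := hxy
    have h3 : (0 : ℝ) < q - p := by linarith
    gcongr
  continuous' := by fun_prop
  map_one' := Set.projIcc_of_right_le _ <| by
    have h1 : (p : ℝ) < q := h
    have h2 : (q : ℝ) ≤ 1 := q.2.2
    rw [le_div_iff₀ (by linarith)]
    simpa using h2

theorem ramp_of_le {p q : I} (h : p < q) {x : I} (hx : x ≤ p) : ramp p q h x = 0 :=
  Set.projIcc_of_le_left zero_le_one <| by
    have h1 : (p : ℝ) < q := h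
    have h2 : (x : ℝ) ≤ p := hx
    exact div_nonpos_of_nonpos_of_nonneg (by linarith) (by linarith)

theorem ramp_of_ge {p q : I} (h : p < q) {x : I} (hx : q ≤ x) : ramp p q h x = 1 :=
  Set.projIcc_of_right_le zero_le_one <| by
    have h1 : (p : ℝ) < q := h
    have h2 : (q : ℝ) ≤ x := hx
    rw [le_div_iff₀ (by linarith)]
    linarith

/-- The map `x ↦ max x r`. -/
def cap (r : I) : UHat where
  toFun x := x ⊔ r
  monotone' _ _ h := sup_le_sup_right h r
  continuous' := by fun_prop
  map_one' := sup_eq_left.mpr le_one'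

theorem cap_apply (r x : I) : cap r x = x ⊔ r := rfl

/-- The pointwise join of two maps. -/
def sup (p q : UHat) : UHat where
  toFun x := p x ⊔ q x
  monotone' _ _ h := sup_le_sup (p.monotone' h) (q.monotone' h)
  continuous' := p.continuous'.max q.continuous'
  map_one' := by rw [show p 1 = 1 from p.map_one', show q 1 = 1 from q.map_one', sup_idem]

theorem le_sup_left (p q : UHat) : p ≤ p.sup q := fun _ => _root_.le_sup_left

theorem le_sup_right (p q : UHat) : q ≤ p.sup q := fun _ => _root_.le_sup_right

theorem inf_apply (p q : UHat) (x : I) : (p ⊓ q) x = p x ⊓ q x := rfl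

theorem finset_inf_apply_le {ι : Type*} (s : Finset ι) (g : ι → UHat) {i : ι} (hi : i ∈ s)
    (x : I) : s.inf g x ≤ g i x :=
  Finset.inf_le (f := g) hi x

end UHat

/-! ### Grids in the unit interval. -/

/-- The midpoint of the unit interval. -/
noncomputable def mid : I := ⟨1 / 2, by norm_num, by norm_num⟩

theorem mid_pos : (0 : I) < mid := by
  change (0 : ℝ) < 1 / 2
  norm_num

theorem mid_lt_one : mid < 1 := by
  change (1 / 2 : ℝ) < 1
  norm_num

/-- The `k`-th point of the subdivision of the unit interval into `N` equal parts. -/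
noncomputable def grid (N k : ℕ) : I := Set.projIcc 0 1 zero_le_one ((k : ℝ) / N)

theorem coe_grid {N k : ℕ} (h : k ≤ N) : (grid N k : ℝ) = k / N := by
  have : (k : ℝ) / N ≤ 1 := div_le_one_of_le₀ (by exact_mod_cast h) (by positivity)
  rw [grid, Set.projIcc_of_mem _ ⟨by positivity, this⟩]

theorem grid_lt_grid {N k l : ℕ} (hkl : k < l) (hl : l ≤ N) : grid N k < grid N l := by
  rw [← Subtype.coe_lt_coe, coe_grid hl, coe_grid (hkl.le.trans hl)]
  have : (0 : ℝ) < N := by exact_mod_cast (by omega : 0 < N)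
  gcongr

/-- A lower bound of the numbers `grid N (k + 1)` with `x < grid N k` is at most `x + 2 / N`. -/
theorem le_add_of_forall_grid {N : ℕ} (hN : 0 < N) {x y : I}
    (h : ∀ k < N, x < grid N k → y ≤ grid N (k + 1)) : (y : ℝ) ≤ x + 2 / N := by
  have hN' : (0 : ℝ) < N := by exact_mod_cast hN
  have hx0 : 0 ≤ (x : ℝ) * N := mul_nonneg x.2.1 hN'.le
  have h1 : ((⌊(x : ℝ) * N⌋₊ : ℕ) : ℝ) ≤ x * N := Nat.floor_le hx0
  have h2 := Nat.lt_floor_add_one ((x : ℝ) * N)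
  set k := ⌊(x : ℝ) * N⌋₊
  have h3 : ((k : ℝ) + 2) / N ≤ x + 2 / N := by
    rw [add_div]
    gcongr
    rwa [div_le_iff₀ hN']
  refine le_trans ?_ h3
  -- Here `k / N ≤ x < (k + 1) / N`, so the hypothesis is applied at `k + 1`, giving `(k + 2) / N ≤
  -- x + 2 / N`. Past the end of the grid, `(k + 2) / N` is already at least `1`.
  by_cases hk : k + 1 < N
  · have h4 := h (k + 1) hk (by
      rw [← Subtype.coe_lt_coe, coe_grid hk.le, lt_div_iff₀ hN']
      push_cast
      exact h2)
    rw [← Subtype.coe_le_coe, coe_grid (by omega)] at h4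
    push_cast at h4
    rwa [add_assoc, one_add_one_eq_two] at h4
  · refine y.2.2.trans ?_
    rw [le_div_iff₀ hN', one_mul]
    have : N ≤ k + 2 := by omega
    exact_mod_cast this

theorem exists_nat_two_div_lt {ε : ℝ} (hε : 0 < ε) : ∃ N : ℕ, 0 < N ∧ 2 / (N : ℝ) < ε := by
  obtain ⟨N, hN⟩ := exists_nat_gt (2 / ε)
  have : 0 < 2 / ε := by positivity
  have hN0 : (0 : ℝ) < N := this.trans hN
  refine ⟨N, by exact_mod_cast hN0, ?_⟩
  rw [div_lt_iff₀ hN0]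
  rwa [div_lt_iff₀ hε, mul_comm] at hN

/-! ### Monotonicity and finite meets in modules. -/

section Module

variable {A : Type u} [SemilatticeInf A] [OrderTop A] [UModule A]

theorem smul_mono_right (p : UHat) {a b : A} (h : a ≤ b) : p • a ≤ p • b := by
  rw [← inf_eq_left, ← UModule.smul_inf, inf_eq_left.mpr h]

theorem smul_mono_left {p q : UHat} (h : p ≤ q) (a : A) : p • a ≤ q • a := by
  rw [← inf_eq_left, ← UModule.inf_smul, inf_eq_left.mpr h]

theorem le_finset_inf_smul {ι : Type*} (s : Finset ι) (g : ι → UHat) (a b : A)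
    (h : ∀ i ∈ s, a ≤ g i • b) : a ≤ s.inf g • b := by
  classical
  induction s using Finset.induction_on with
  | empty => simp [UModule.top_smul]
  | insert i s _ ih =>
    rw [Finset.inf_insert, UModule.inf_smul]
    exact le_inf (h i (by simp)) (ih fun j hj => h j (by simp [hj]))

theorem UModHom.mono (f : UModHom A I) : Monotone f := fun a b h => by
  rw [← inf_eq_left, ← f.map_inf, inf_eq_left.mpr h]

theorem UModHom.map_finset_inf {ι : Type*} (f : UModHom A I) (s : Finset ι) (c : ι → A) :
    f (s.inf c) = s.inf fun i => f (c i) := by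
  classical
  induction s using Finset.induction_on with
  | empty => exact f.map_top
  | insert i s _ ih => rw [Finset.inf_insert, Finset.inf_insert, f.map_inf, ih]

/-! ### Separation of points of an Archimedean module -/

/-- The relation saying that every morphism `f` with `r ≤ f a` has `t < f b`. -/
def Forces (a : A) (r : I) (b : A) (t : I) : Prop :=
  ∃ p q : UHat, p r = 1 ∧ q t = 0 ∧ p • a ≤ q • b

/-- There is room above `t`: `q` climbs continuously from `0` to `1`, so it takes the value `1 / 2`
at some `t' > t`. Postcomposing `p` and `q` with the ramp from `1 / 2` to `1` keeps `1` and kills `q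
t'`. -/
theorem Forces.exists_gt {a b : A} {r t : I} (h : Forces a r b t) :
    ∃ t', t < t' ∧ Forces a r b t' := by
  obtain ⟨p, q, hp, hq, hpq⟩ := h
  obtain ⟨t', ht', hqt'⟩ := intermediate_value_Icc (le_one' : t ≤ 1) q.continuous'.continuousOn
    (show mid ∈ Set.Icc (q t) (q 1) by
      rw [hq, q.map_one]
      exact ⟨mid_pos.le, mid_lt_one.le⟩)
  have hqt : q t' = mid := hqt'
  refine ⟨t', lt_of_le_of_ne ht'.1 ?_, UHat.ramp mid 1 mid_lt_one * p,
    UHat.ramp mid 1 mid_lt_one * q, ?_, ?_, ?_⟩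
  · rintro rfl
    exact mid_pos.ne (hq.symm.trans hqt)
  · rw [UHat.mul_apply, hp, UHat.map_one]
  · rw [UHat.mul_apply, hqt, UHat.ramp_of_le _ le_rfl]
  · rw [mul_smul, mul_smul]
    exact smul_mono_right _ hpq

theorem Forces.of_le {a b : A} {r t s : I} (h : Forces a r b t) (hs : s ≤ t) :
    Forces a r b s := by
  obtain ⟨p, q, hp, hq, hpq⟩ := h
  exact ⟨p, q, hp, le_antisymm ((q.mono hs).trans_eq hq) nonneg', hpq⟩

/-- The forced values form a down-set with no greatest element. This lets strict inequalities with
the supremum be replaced by explicit witnesses `p`, `q`. -/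
theorem lt_sSup_forces_iff {a b : A} {r t : I} :
    t < sSup {t | Forces a r b t} ↔ Forces a r b t := by
  constructor
  · intro h
    obtain ⟨s, hs, hts⟩ := lt_sSup_iff.mp h
    exact hs.of_le hts.le
  · intro h
    obtain ⟨s, hts, hs⟩ := h.exists_gt
    exact hts.trans_le (le_sSup hs)

/-- The least morphism `f` into the unit interval with `r ≤ f a`. -/
noncomputable def forcingHom (a : A) (r : I) : UModHom A I where
  toFun b := sSup {t | Forces a r b t}
  map_inf' b c := eq_of_forall_lt_iff fun t => by
    rw [lt_inf_iff, lt_sSup_forces_iff, lt_sSup_forces_iff, lt_sSup_forces_iff]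
    constructor
    · rintro ⟨p, q, hp, hq, hpq⟩
      exact ⟨⟨p, q, hp, hq, hpq.trans (smul_mono_right q inf_le_left)⟩,
        ⟨p, q, hp, hq, hpq.trans (smul_mono_right q inf_le_right)⟩⟩
    · rintro ⟨⟨p, q, hp, hq, hpq⟩, ⟨p', q', hp', hq', hpq'⟩⟩
      refine ⟨p ⊓ p', q.sup q', ?_, ?_, ?_⟩
      · rw [UHat.inf_apply, hp, hp', inf_idem]
      · change q t ⊔ q' t = 0
        rw [hq, hq', sup_idem]
      · rw [UModule.inf_smul, UModule.smul_inf]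
        exact inf_le_inf (hpq.trans (smul_mono_left (UHat.le_sup_left q q') b))
          (hpq'.trans (smul_mono_left (UHat.le_sup_right q q') c))
  map_top' := eq_of_forall_lt_iff fun t => by
    rw [lt_sSup_forces_iff]
    refine ⟨fun ⟨p, q, hp, hq, hpq⟩ => ?_, fun h => ?_⟩
    · refine lt_of_le_of_ne le_top ?_
      rintro rfl
      exact zero_ne_one (hq.symm.trans q.map_one)
    · exact ⟨⊤, UHat.ramp t 1 h, rfl, UHat.ramp_of_le _ le_rfl,
        by rw [UModule.smul_top]; exact le_top⟩
  map_smul' w b := eq_of_forall_lt_iff fun t => by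
    rw [lt_sSup_forces_iff]
    change _ ↔ t < w (sSup {t | Forces a r b t})
    constructor
    · rintro ⟨p, q, hp, hq, hpq⟩
      by_contra hlt
      -- If `w` sent the supremum to at most `t`, then `q * w` would vanish there, so the supremum
      -- would itself be forced, hence less than itself.
      refine lt_irrefl _ (lt_sSup_forces_iff.mpr (⟨p, q * w, hp, ?_, ?_⟩ :
        Forces a r b (sSup {t | Forces a r b t})))
      · rw [UHat.mul_apply]
        exact le_antisymm ((q.mono (not_lt.mp hlt)).trans_eq hq) nonneg'
      · rwa [mul_smul]
    · intro h
      -- Maps in `Û` need not fix `0`, so they preserve only nonempty joins. With nothing forced, `t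
      -- < w 0`, and the ramp from `t` to `w 0` composed with `w` is constantly `1`.
      rcases Set.eq_empty_or_nonempty {t | Forces a r b t} with hS | hS
      · rw [hS, sSup_empty] at h
        refine ⟨⊤, UHat.ramp t (w ⊥) h, rfl, UHat.ramp_of_le _ le_rfl, ?_⟩
        have : UHat.ramp t (w ⊥) h * w = ⊤ :=
          UHat.hom_ext fun x => UHat.ramp_of_ge h (w.mono bot_le)
        rw [← mul_smul, this, UModule.top_smul, UModule.top_smul]
      · rw [w.map_sSup _ hS] at h
        obtain ⟨_, ⟨s, ⟨p, q, hp, hq, hpq⟩, rfl⟩, hts⟩ := lt_sSup_iff.mp h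
        refine ⟨p, UHat.ramp t (w s) hts, hp, UHat.ramp_of_le _ le_rfl, ?_⟩
        rw [← mul_smul]
        -- The new map dominates `q`: up to `s` the map `q` vanishes, and from `s` on the new map is
        -- `1`.
        refine hpq.trans (smul_mono_left (fun x => ?_) b)
        rcases le_total x s with hx | hx
        · exact ((q.mono hx).trans_eq hq).trans nonneg'
        · exact le_one'.trans_eq (UHat.ramp_of_ge hts (w.mono hx)).symm

theorem lt_forcingHom_iff {a b : A} {r t : I} : t < forcingHom a r b ↔ Forces a r b t :=
  lt_sSup_forces_iff

theorem le_forcingHom_self (a : A) (r : I) : r ≤ forcingHom a r a :=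
  le_of_forall_lt fun t ht => lt_forcingHom_iff.mpr
    ⟨UHat.ramp t r ht, UHat.ramp t r ht, UHat.ramp_of_ge _ le_rfl, UHat.ramp_of_le _ le_rfl, le_rfl⟩

theorem rho_le_of_le_shift {a b : A} {r : I} (h : a ≤ UHat.shift r • b) : rho a b ≤ r := sInf_le h

/-- Morphisms into the unit interval determine the order of an Archimedean module. -/
theorem le_of_forall_hom_le (hA : IsArchimedean A) {a b : A}
    (h : ∀ f : UModHom A I, f a ≤ f b) : a ≤ b := by
  refine hA a b (le_antisymm ?_ nonneg')
  change (rho a b : ℝ) ≤ 0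
  refine le_of_forall_pos_le_add fun ε hε => ?_
  rw [zero_add]
  obtain ⟨N, hN, hNε⟩ := exists_nat_two_div_lt hε
  rcases le_total 1 ε with hε1 | hε1
  · exact (rho a b).2.2.trans hε1
  have key : ∀ k < N, ∃ p q : UHat,
      p (grid N (k + 1)) = 1 ∧ q (grid N k) = 0 ∧ p • a ≤ q • b := fun k hk =>
    lt_forcingHom_iff.mp <| (grid_lt_grid k.lt_succ_self hk).trans_le <|
      (le_forcingHom_self a (grid N (k + 1))).trans (h _)
  choose! p q hp hq hpq using key
  -- Capping `p k` from below by `(k + 1) / N` makes it at least the identity, since `p k` is `1`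
  -- from that point on. Capping `q k` makes it equal to `(k + 1) / N` up to `k / N`, so the meet of
  -- the capped maps is at most `x ↦ x + 2 / N`.
  let g : ℕ → UHat := fun k => UHat.cap (grid N (k + 1)) * q k
  have h1 : a ≤ (Finset.range N).inf g • b := le_finset_inf_smul _ _ _ _ fun k hk => by
    have hk' := Finset.mem_range.mp hk
    have h2 : (1 : UHat) ≤ UHat.cap (grid N (k + 1)) * p k := fun x => by
      rw [UHat.mul_apply, UHat.cap_apply]
      change x ≤ _
      rcases le_total x (grid N (k + 1)) with hx | hx
      · exact hx.trans le_sup_right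
      · have h3 : p k x = 1 := le_antisymm le_one' ((hp k hk').symm.trans_le ((p k).mono hx))
        rw [h3]
        exact le_one'.trans le_sup_left
    calc a = (1 : UHat) • a := (one_smul _ a).symm
      _ ≤ (UHat.cap (grid N (k + 1)) * p k) • a := smul_mono_left h2 a
      _ ≤ (UHat.cap (grid N (k + 1)) * q k) • b := by
        rw [mul_smul, mul_smul]
        exact smul_mono_right _ (hpq k hk')
  have h2 : (Finset.range N).inf g ≤ UHat.shift ⟨ε, hε.le, hε1⟩ := fun x => by
    change _ ≤ tadd x ⟨ε, hε.le, hε1⟩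
    rw [le_tadd_iff]
    have h3 := le_add_of_forall_grid hN (x := x) (y := (Finset.range N).inf g x) fun k hk hx => by
      refine (UHat.finset_inf_apply_le _ g (Finset.mem_range.mpr hk) x).trans ?_
      have h4 : q k x = 0 := le_antisymm (((q k).mono hx.le).trans_eq (hq k hk)) nonneg'
      change q k x ⊔ _ ≤ _
      rw [h4]
      exact sup_le nonneg' le_rfl
    change _ ≤ (x : ℝ) + ε
    linarith
  exact rho_le_of_le_shift (h1.trans (smul_mono_left h2 b))

theorem eval_le_eval_iff (hA : IsArchimedean A) {a b : A} :
    UModHom.eval A a ≤ UModHom.eval A b ↔ a ≤ b :=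
  ⟨fun h => le_of_forall_hom_le hA h, fun h f => f.mono h⟩

theorem eval_injective (hA : IsArchimedean A) : Function.Injective (UModHom.eval A) :=
  fun _ _ h => le_antisymm ((eval_le_eval_iff hA).mp h.le) ((eval_le_eval_iff hA).mp h.ge)

/-- Evaluation is equivariant and reflects the order, so the two infima range over the same set. -/
theorem rho_eval (hA : IsArchimedean A) (a b : A) :
    rho (UModHom.eval A a) (UModHom.eval A b) = rho a b := by
  unfold rho
  congr 1
  ext r
  change _ ≤ UHat.shift r • UModHom.eval A b ↔ _
  rw [← UModHom.map_smul, eval_le_eval_iff hA]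
  rfl

theorem udist_eval (hA : IsArchimedean A) (a b : A) :
    udist (UModHom.eval A a) (UModHom.eval A b) = udist a b := by
  rw [udist, udist, rho_eval hA, rho_eval hA]

/-! ### Surjectivity of evaluation for a complete module -/

/-- As `F` preserves meets, `s ≤ F f` means `h ≤ f` for a least `h`. This `h` lies below the
directed join of the least morphisms that are at least `1 / 2` at `c`, over all `c` with `h c = 1`.
As `F` preserves directed joins, `F` exceeds `r` on one of them, and its `c` is the element sought.
-/
theorem exists_interpolating_element (F : CtsLatHom (UModHom A I) I) {r s : I} (hrs : r < s) :
    ∃ c : A, (∀ f, s ≤ F f → f c = 1) ∧ ∀ f, mid ≤ f c → r ≤ F f := by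
  set h : UModHom A I := sInf {f | s ≤ F f} with hh
  have hFh : s ≤ F h := by
    rw [hh, F.map_sInf]
    refine le_sInf ?_
    rintro _ ⟨f, hf, rfl⟩
    exact hf
  let m : A → UModHom A I := fun c => sInf {g | mid ≤ g c}
  have hm : ∀ c, mid ≤ m c c := fun c => by
    rw [UModHom.sInf_apply]
    refine le_sInf ?_
    rintro _ ⟨g, hg, rfl⟩
    exact hg
  let D : Set (UModHom A I) := m '' {c | h c = 1}
  have hD : D.Nonempty := ⟨_, ⊤, h.map_top, rfl⟩
  have hD' : DirectedOn (· ≤ ·) D := by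
    rintro _ ⟨b, hb, rfl⟩ _ ⟨c, hc, rfl⟩
    refine ⟨m (b ⊓ c), ⟨b ⊓ c, ?_, rfl⟩, sInf_le ?_, sInf_le ?_⟩
    · change h (b ⊓ c) = 1
      rw [h.map_inf, show h b = 1 from hb, show h c = 1 from hc, inf_idem]
    · exact (hm _).trans ((m (b ⊓ c)).mono inf_le_left)
    · exact (hm _).trans ((m (b ⊓ c)).mono inf_le_right)
  have hle : h ≤ sSup D := fun a => le_of_forall_lt_imp_le_of_dense fun t ht => by
    -- The ramp gives `h c = 1`, while a morphism whose value at `a` is below `t` vanishes at `c`;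
    -- hence `m c a` is at least `t`.
    let c : A := UHat.ramp t (h a) ht • a
    have hc : h c = 1 := by
      rw [UModHom.smul_apply]
      exact UHat.ramp_of_ge _ le_rfl
    refine le_trans ?_ ((le_sSup ⟨c, hc, rfl⟩ : m c ≤ sSup D) a)
    by_contra hlt
    have h1 := hm c
    rw [UModHom.smul_apply, UHat.ramp_of_le ht (not_le.mp hlt).le] at h1
    exact h1.not_gt mid_pos
  have h1 : r < F (sSup D) := hrs.trans_le (hFh.trans (F.mono hle))
  rw [F.map_sSup D hD hD'] at h1
  obtain ⟨_, ⟨_, ⟨c, hc, rfl⟩, rfl⟩, h2⟩ := lt_sSup_iff.mp h1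
  refine ⟨c, fun f hf => le_antisymm le_one' ?_, fun f hf => ?_⟩
  · rw [← show h c = 1 from hc]
    exact (sInf_le hf : h ≤ f) c
  · exact h2.le.trans (F.mono (sInf_le hf))

/-- Evaluations are uniformly dense in the double dual. -/
theorem exists_eval_approx (F : CtsLatHom (UModHom A I) I) {ε : ℝ} (hε : 0 < ε) :
    ∃ a : A, ∀ f, (F f : ℝ) ≤ f a ∧ (f a : ℝ) ≤ F f + ε := by
  obtain ⟨N, hN, hNε⟩ := exists_nat_two_div_lt hε
  have key : ∀ k < N, ∃ c : A, (∀ f, grid N (k + 1) ≤ F f → f c = 1) ∧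
      ∀ f, mid ≤ f c → grid N k ≤ F f := fun k hk =>
    exists_interpolating_element F (grid_lt_grid k.lt_succ_self hk)
  choose! c hc hc' using key
  -- The value of `f` at `d k` is always at least `(k + 1) / N`. It is `1` when `F f ≥ (k + 1) / N`,
  -- and exactly `(k + 1) / N` when `F f < k / N`, since then `f (c k) < 1 / 2`.
  let d : ℕ → A := fun k => (UHat.cap (grid N (k + 1)) * UHat.ramp mid 1 mid_lt_one) • c k
  have hd : ∀ (f : UModHom A I) k,
      f (d k) = UHat.ramp mid 1 mid_lt_one (f (c k)) ⊔ grid N (k + 1) := fun f k => by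
    rw [UModHom.smul_apply]
    rfl
  refine ⟨(Finset.range N).inf d, fun f => ⟨?_, ?_⟩⟩
  · change F f ≤ _
    rw [UModHom.map_finset_inf]
    refine Finset.le_inf fun k hk => ?_
    rw [hd]
    rcases le_total (F f) (grid N (k + 1)) with hx | hx
    · exact hx.trans le_sup_right
    · rw [hc k (Finset.mem_range.mp hk) f hx, UHat.map_one]
      exact le_one'.trans le_sup_left
  · have h3 := le_add_of_forall_grid hN (x := F f) (y := f ((Finset.range N).inf d))
      fun k hk hx => by
        rw [UModHom.map_finset_inf]
        refine (Finset.inf_le (Finset.mem_range.mpr hk)).trans ?_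
        have h4 : f (c k) ≤ mid := by
          by_contra hlt
          exact hx.not_ge (hc' k hk f (not_le.mp hlt).le)
        rw [hd, UHat.ramp_of_le _ h4]
        exact sup_le nonneg' le_rfl
    linarith

/-- Evaluation is isometric, so elements whose evaluations approximate `F` within `1 / (n + 1)` form
a Cauchy sequence, and its limit evaluates to `F`. -/
theorem eval_surjective (hA : IsComplete A) : Function.Surjective (UModHom.eval A) := by
  intro F
  choose! s hs using fun ε hε => exists_eval_approx F (ε := ε) hε
  have hpos : ∀ n : ℕ, (0 : ℝ) < 1 / ((n : ℝ) + 1) := fun n => Nat.one_div_pos_of_nat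
  let t : ℕ → A := fun n => s (1 / ((n : ℝ) + 1))
  have ht := fun n : ℕ => hs _ (hpos n)
  have small : ∀ ε : ℝ, 0 < ε → ∃ N : ℕ, ∀ n ≥ N, 1 / ((n : ℝ) + 1) < ε := fun ε hε => by
    obtain ⟨N, hN⟩ := exists_nat_one_div_lt hε
    exact ⟨N, fun n hn => (Nat.one_div_le_one_div hn).trans_lt hN⟩
  have hrho : ∀ (G H : CtsLatHom (UModHom A I) I) {ε : ℝ}, 0 < ε → (∀ f, (G f : ℝ) ≤ H f + ε) →
      (∀ f, (H f : ℝ) ≤ G f + ε) → (udist G H : ℝ) ≤ ε := fun G H ε hε h1 h2 => by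
    have h3 := CtsLatHom.rho_le hε.le h1
    have h4 := CtsLatHom.rho_le hε.le h2
    rcases le_total (rho G H) (rho H G) with h | h
    · rwa [udist, sup_eq_right.mpr h]
    · rwa [udist, sup_eq_left.mpr h]
  obtain ⟨a, ha⟩ := hA.2 t fun ε hε => by
    obtain ⟨N, hN⟩ := small (ε / 2) (by linarith)
    refine ⟨N, fun m hm n hn => ?_⟩
    rw [← udist_eval hA.1]
    refine lt_of_le_of_lt (hrho _ _ (half_pos hε) (fun f => ?_) fun f => ?_) (half_lt_self hε)
    · change (f (t m) : ℝ) ≤ f (t n) + ε / 2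
      have h1 : (f (t m) : ℝ) ≤ F f + 1 / ((m : ℝ) + 1) := (ht m f).2
      have h2 : (F f : ℝ) ≤ f (t n) := (ht n f).1
      linarith [hN m hm]
    · change (f (t n) : ℝ) ≤ f (t m) + ε / 2
      have h1 : (f (t n) : ℝ) ≤ F f + 1 / ((n : ℝ) + 1) := (ht n f).2
      have h2 : (F f : ℝ) ≤ f (t m) := (ht m f).1
      linarith [hN n hn]
  refine ⟨a, CtsLatHom.hom_ext fun f => ?_⟩
  have h1 : ∀ ε : ℝ, 0 < ε → (f a : ℝ) ≤ F f + ε ∧ (F f : ℝ) ≤ f a + ε := fun ε hε => by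
    obtain ⟨N, hN⟩ := small (ε / 2) (by linarith)
    obtain ⟨M, hM⟩ := ha (ε / 2) (by linarith)
    have h2 := hM (max M N) (le_max_left _ _)
    have h3 := hN (max M N) (le_max_right _ _)
    have h4 := ht (max M N) f
    rw [← udist_eval hA.1] at h2
    have h5 : (f (t (max M N)) : ℝ) ≤ f a + ε / 2 :=
      CtsLatHom.le_add_of_rho_lt (lt_of_le_of_lt (Subtype.coe_le_coe.mpr le_sup_left) h2) f
    have h6 : (f a : ℝ) ≤ f (t (max M N)) + ε / 2 :=
      CtsLatHom.le_add_of_rho_lt (lt_of_le_of_lt (Subtype.coe_le_coe.mpr le_sup_right) h2) f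
    have h7 : (f (t (max M N)) : ℝ) ≤ F f + 1 / (((max M N : ℕ) : ℝ) + 1) := h4.2
    have h8 : (F f : ℝ) ≤ f (t (max M N)) := h4.1
    constructor <;> linarith
  exact le_antisymm (le_of_forall_pos_le_add fun ε hε => (h1 ε hε).1 : (f a : ℝ) ≤ F f)
    (le_of_forall_pos_le_add fun ε hε => (h1 ε hε).2 : (F f : ℝ) ≤ f a)

end Module

/-! ### Dyadic scales -/

section Scale

variable {X : Type u} (btw : X → X → X) (a b : X)

/-- A dyadic scale from `a` to `b`: the `n`-th row has entries for `0, …, 2 ^ n`, and each row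
refines the previous one by inserting chosen intermediate elements. -/
def dyadicScale : ℕ → ℕ → X
  | 0, k => if k = 0 then a else b
  | n + 1, k => if k % 2 = 0 then dyadicScale n (k / 2)
      else btw (dyadicScale n (k / 2)) (dyadicScale n (k / 2 + 1))

variable {btw a b}

theorem dyadicScale_succ_double (n k : ℕ) :
    dyadicScale btw a b (n + 1) (2 * k) = dyadicScale btw a b n k := by
  rw [dyadicScale, if_pos (by omega), show 2 * k / 2 = k by omega]

/-- An entry depends only on the dyadic number `k / 2 ^ n`, so entries of different rows can be
compared in a common row. -/
theorem dyadicScale_add (n m k : ℕ) :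
    dyadicScale btw a b (n + m) (2 ^ m * k) = dyadicScale btw a b n k := by
  induction m with
  | zero => simp
  | succ m ih => rw [← add_assoc, pow_succ', mul_assoc, dyadicScale_succ_double, ih]

theorem dyadicScale_zero (n : ℕ) : dyadicScale btw a b n 0 = a := by
  have := dyadicScale_add (btw := btw) (a := a) (b := b) 0 n 0
  rwa [zero_add, mul_zero, dyadicScale, if_pos rfl] at this

theorem dyadicScale_two_pow (n : ℕ) : dyadicScale btw a b n (2 ^ n) = b := by
  have := dyadicScale_add (btw := btw) (a := a) (b := b) 0 n 1
  rwa [zero_add, mul_one, dyadicScale, if_neg one_ne_zero] at this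

end Scale

section Lattice

variable {X : Type u} [CompleteLattice X]

/-! ### The way-below relation -/

theorem WayBelow.le {x y : X} (h : WayBelow y x) : y ≤ x := by
  obtain ⟨d, hd, h⟩ := h {x} (Set.singleton_nonempty x) (by simp [DirectedOn]) (by simp)
  rw [Set.mem_singleton_iff] at hd
  exact hd ▸ h

theorem WayBelow.mono {x x' y y' : X} (h : WayBelow y x) (hy : y' ≤ y) (hx : x ≤ x') :
    WayBelow y' x' := fun D hD hD' hle => by
  obtain ⟨d, hd, h⟩ := h D hD hD' (hx.trans hle)
  exact ⟨d, hd, hy.trans h⟩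

theorem wayBelow_bot (x : X) : WayBelow ⊥ x := fun _ ⟨d, hd⟩ _ _ => ⟨d, hd, bot_le⟩

theorem WayBelow.sup {x y z : X} (hy : WayBelow y x) (hz : WayBelow z x) : WayBelow (y ⊔ z) x :=
  fun D hD hD' hle => by
    obtain ⟨d, hd, hyd⟩ := hy D hD hD' hle
    obtain ⟨e, he, hze⟩ := hz D hD hD' hle
    obtain ⟨c, hc, hdc, hec⟩ := hD' d hd e he
    exact ⟨c, hc, sup_le (hyd.trans hdc) (hze.trans hec)⟩

/-- The way-below relation of a continuous lattice interpolates. -/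
theorem WayBelow.exists_between [IsContinuousLattice X] {a x : X} (h : WayBelow a x) :
    ∃ m, WayBelow a m ∧ WayBelow m x := by
  -- This set is directed because way-below is compatible with binary joins, and applying continuity
  -- twice shows that its join is at least `x`. So `a ≪ x` puts `a` below one of its members.
  obtain ⟨d, ⟨m, hdm, hmx⟩, had⟩ := h {d | ∃ m, WayBelow d m ∧ WayBelow m x}
    ⟨⊥, ⊥, wayBelow_bot _, wayBelow_bot _⟩
    (by
      rintro d ⟨m, hdm, hmx⟩ d' ⟨m', hdm', hmx'⟩
      exact ⟨d ⊔ d', ⟨m ⊔ m', (hdm.mono le_rfl le_sup_left).sup (hdm'.mono le_rfl le_sup_right),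
        hmx.sup hmx'⟩, le_sup_left, le_sup_right⟩)
    (by
      rw [← IsContinuousLattice.sSup_wayBelow x]
      refine sSup_le fun m hm => ?_
      rw [← IsContinuousLattice.sSup_wayBelow m]
      refine sSup_le fun d hd => le_sSup ⟨m, hd, ?_⟩
      rwa [IsContinuousLattice.sSup_wayBelow x])
  exact ⟨m, hdm.mono had le_rfl, hmx⟩

/-- Of two neighbours in row `n + 1`, one is inherited from row `n` and the other was inserted
between it and the next or previous inherited entry. -/
theorem dyadicScale_wayBelow_succ {btw : X → X → X} {a b : X}
    (hbtw : ∀ x y : X, WayBelow x y →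
      WayBelow x (btw x y) ∧ WayBelow (btw x y) y) (hab : WayBelow a b) (n k : ℕ)
    (hk : k < 2 ^ n) :
    WayBelow (dyadicScale btw a b n k) (dyadicScale btw a b n (k + 1)) := by
  induction n generalizing k with
  | zero =>
    obtain rfl : k = 0 := by simpa using hk
    simpa [dyadicScale] using hab
  | succ n ih =>
    rw [pow_succ] at hk
    have h := hbtw _ _ (ih (k / 2) (by omega))
    rcases Nat.mod_two_eq_zero_or_one k with h2 | h2
    · rw [dyadicScale, if_pos h2, dyadicScale, if_neg (by omega),
        show (k + 1) / 2 = k / 2 by omega]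
      exact h.1
    · rw [dyadicScale, if_neg (by omega), dyadicScale, if_pos (by omega),
        show (k + 1) / 2 = k / 2 + 1 by omega]
      exact h.2

theorem dyadicScale_wayBelow {btw : X → X → X} {a b : X}
    (hbtw : ∀ x y : X, WayBelow x y →
      WayBelow x (btw x y) ∧ WayBelow (btw x y) y) (hab : WayBelow a b) (n : ℕ) {k l : ℕ}
    (hkl : k < l) (hl : l ≤ 2 ^ n) :
    WayBelow (dyadicScale btw a b n k) (dyadicScale btw a b n l) := by
  induction l, hkl using Nat.le_induction with
  | base => exact dyadicScale_wayBelow_succ hbtw hab n k hl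
  | succ l hl' ih =>
    exact (ih (by omega)).mono le_rfl (dyadicScale_wayBelow_succ hbtw hab n l hl).le

/-- Between an element and one way below it there is a family, indexed by the dyadic numbers in
the unit interval, which is increasing for the way-below relation. -/
theorem WayBelow.exists_family [IsContinuousLattice X] {a b : X} (h : WayBelow a b) :
    ∃ z : {q : I // ∃ n k : ℕ, (q : ℝ) = k / 2 ^ n} → X, (∀ q, a ≤ z q) ∧ (∀ q, z q ≤ b) ∧
      ∀ p q, p < q → WayBelow (z p) (z q) := by
  -- The interpolant is made total with a junk value, so that the scale can be defined without
  -- carrying proofs.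
  have : ∀ x y : X, ∃ m, WayBelow x y → WayBelow x m ∧ WayBelow m y := fun x y => by
    by_cases hxy : WayBelow x y
    · obtain ⟨m, hm⟩ := hxy.exists_between
      exact ⟨m, fun _ => hm⟩
    · exact ⟨x, fun h => absurd h hxy⟩
  choose btw hbtw using this
  have hle : ∀ (q : {q : I // ∃ n k : ℕ, (q : ℝ) = k / 2 ^ n}) (n k : ℕ),
      ((q : I) : ℝ) = k / 2 ^ n → k ≤ 2 ^ n := fun q n k hq => by
    have h1 : ((q : I) : ℝ) ≤ 1 := q.1.2.2
    rw [hq, div_le_one (by positivity)] at h1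
    exact_mod_cast h1
  have hmono : ∀ (n k l : ℕ), k ≤ l → l ≤ 2 ^ n →
      dyadicScale btw a b n k ≤ dyadicScale btw a b n l := fun n k l hkl hl => by
    rcases hkl.eq_or_lt with rfl | hkl
    · exact le_rfl
    · exact (dyadicScale_wayBelow hbtw h n hkl hl).le
  choose n k hq using fun q : {q : I // ∃ n k : ℕ, (q : ℝ) = k / 2 ^ n} => q.2
  refine ⟨fun q => dyadicScale btw a b (n q) (k q), fun q => ?_, fun q => ?_, fun p q hpq => ?_⟩
  · change a ≤ dyadicScale btw a b (n q) (k q)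
    refine (dyadicScale_zero (btw := btw) (a := a) (b := b) (n q)).ge.trans ?_
    exact hmono _ _ _ (Nat.zero_le _) (hle q _ _ (hq q))
  · change dyadicScale btw a b (n q) (k q) ≤ b
    refine le_trans ?_ (dyadicScale_two_pow (btw := btw) (a := a) (b := b) (n q)).le
    exact hmono _ _ _ (hle q _ _ (hq q)) le_rfl
  · have h1 : ((p : I) : ℝ) < (q : I) := hpq
    rw [hq p, hq q, div_lt_div_iff₀ (by positivity) (by positivity)] at h1
    have h2 : 2 ^ n q * k p < 2 ^ n p * k q := by
      rw [mul_comm, mul_comm (2 ^ n p)]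
      exact_mod_cast h1
    -- Both chosen fractions are rewritten with the common denominator `2 ^ (n p + n q)`.
    have h3 := dyadicScale_wayBelow hbtw h (n p + n q) h2 (by
      rw [pow_add]
      exact Nat.mul_le_mul_left _ (hle q _ _ (hq q)))
    rw [dyadicScale_add, add_comm (n p), dyadicScale_add] at h3
    exact h3

/-- Once `2⁻ⁿ < y - x`, the first multiple of `2⁻ⁿ` strictly above `x` lies below `y`. -/
theorem exists_dyadic_between {x y : I} (h : x < y) :
    ∃ q : {q : I // ∃ n k : ℕ, (q : ℝ) = k / 2 ^ n}, x < q.1 ∧ q.1 < y := by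
  have hx : (0 : ℝ) ≤ x := x.2.1
  have hy : (y : ℝ) ≤ 1 := y.2.2
  have h' : (0 : ℝ) < y - x := sub_pos.mpr h
  obtain ⟨n, hn⟩ := exists_pow_lt_of_lt_one h' (by norm_num : (1 / 2 : ℝ) < 1)
  have hp : (0 : ℝ) < 2 ^ n := by positivity
  rw [one_div_pow] at hn
  have h1 := Nat.lt_floor_add_one ((x : ℝ) * 2 ^ n)
  have h2 : ((⌊(x : ℝ) * 2 ^ n⌋₊ : ℕ) : ℝ) ≤ x * 2 ^ n := Nat.floor_le (by positivity)
  set k := ⌊(x : ℝ) * 2 ^ n⌋₊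
  have h3 : (x : ℝ) < ((k + 1 : ℕ) : ℝ) / 2 ^ n := by
    rw [lt_div_iff₀ hp]
    push_cast
    exact h1
  have h4 : ((k + 1 : ℕ) : ℝ) / 2 ^ n < y := by
    push_cast
    rw [add_div]
    have : (k : ℝ) / 2 ^ n ≤ x := by rwa [div_le_iff₀ hp]
    linarith
  exact ⟨⟨⟨((k + 1 : ℕ) : ℝ) / 2 ^ n, by linarith, by linarith⟩, n, k + 1, rfl⟩, h3, h4⟩

/-! ### Separation of points of a continuous lattice -/

/-- An instance of Urysohn's lemma for continuous lattices. -/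
theorem WayBelow.exists_hom [IsContinuousLattice X] {a b : X} (h : WayBelow a b) :
    ∃ f : CtsLatHom X I, f b = 1 ∧ ∀ y, ¬ a ≤ y → f y = 0 := by
  obtain ⟨z, hza, hzb, hz⟩ := h.exists_family
  let L : X → I := fun y => sSup {r | ∃ q, q.1 = r ∧ z q ≤ y}
  have hlt : ∀ {y : X} {r : I}, r < L y ↔ ∃ q, r < q.1 ∧ z q ≤ y := fun {y r} => by
    rw [lt_sSup_iff]
    constructor
    · rintro ⟨_, ⟨q, rfl, hq⟩, hr⟩
      exact ⟨q, hr, hq⟩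
    · rintro ⟨q, hr, hq⟩
      exact ⟨q, ⟨q, rfl, hq⟩, hr⟩
  have hmono : Monotone L := fun x y hxy => le_of_forall_lt fun r hr => by
    obtain ⟨q, hr, hq⟩ := hlt.mp hr
    exact hlt.mpr ⟨q, hr, hq.trans hxy⟩
  refine ⟨⟨L, fun S => le_antisymm ?_ ?_, fun D hD hD' => le_antisymm ?_ ?_⟩, ?_, fun y hy => ?_⟩
  · refine le_sInf ?_
    rintro _ ⟨y, hy, rfl⟩
    exact hmono (sInf_le hy)
  · refine le_of_forall_lt fun r hr => ?_
    obtain ⟨q, hrq, hq⟩ := exists_dyadic_between hr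
    -- Choosing `q` strictly below the infimum makes one element `z q` work for all `y` in `S` at
    -- once.
    refine hlt.mpr ⟨q, hrq, le_sInf fun y hy => ?_⟩
    obtain ⟨q', hqq', hq'⟩ := hlt.mp (hq.trans_le (sInf_le ⟨y, hy, rfl⟩))
    exact (hz q q' hqq').le.trans hq'
  · refine le_of_forall_lt fun r hr => ?_
    obtain ⟨q, hrq, hq⟩ := hlt.mp hr
    -- Lowering `q` to `q'` gives `z q' ≪ z q ≤ sSup D`, so `z q'` is below a single member of `D`.
    obtain ⟨q', hrq', hqq'⟩ := exists_dyadic_between hrq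
    obtain ⟨d, hd, hqd⟩ := hz q' q hqq' D hD hD' hq
    exact (hlt.mpr ⟨q', hrq', hqd⟩).trans_le (le_sSup ⟨d, hd, rfl⟩)
  · refine sSup_le ?_
    rintro _ ⟨y, hy, rfl⟩
    exact hmono (le_sSup hy)
  · refine le_antisymm le_one' (le_of_forall_lt fun r hr => ?_)
    obtain ⟨q, hrq, -⟩ := exists_dyadic_between hr
    exact hlt.mpr ⟨q, hrq, hzb q⟩
  · refine le_antisymm (sSup_le ?_) nonneg'
    rintro _ ⟨q, -, hq⟩
    exact absurd ((hza q).trans hq) hy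

/-- Morphisms into the unit interval determine the order of a continuous lattice. -/
theorem le_of_forall_ctsLatHom_le [IsContinuousLattice X] {x y : X}
    (h : ∀ f : CtsLatHom X I, f x ≤ f y) : x ≤ y := by
  rw [← IsContinuousLattice.sSup_wayBelow x]
  refine sSup_le fun a ha => ?_
  by_contra hay
  obtain ⟨f, hf, hf'⟩ := WayBelow.exists_hom ha
  have h1 := h f
  rw [hf, hf' y hay] at h1
  exact h1.not_gt zero_lt_one

theorem CtsLatHom.eval_injective [IsContinuousLattice X] : Function.Injective (CtsLatHom.eval X) :=
  fun x y h => le_antisymm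
    (le_of_forall_ctsLatHom_le fun f => (DFunLike.congr_fun h f : f x = f y).le)
    (le_of_forall_ctsLatHom_le fun f => (DFunLike.congr_fun h f : f x = f y).ge)

/-- Every morphism on the dual of a complete lattice is an evaluation. -/
theorem CtsLatHom.eval_surjective : Function.Surjective (CtsLatHom.eval X) := by
  intro Φ
  let m : CtsLatHom X I → X := fun g => sInf {x | mid ≤ g x}
  have hm : ∀ g : CtsLatHom X I, mid ≤ g (m g) := fun g => by
    rw [g.map_sInf]
    refine le_sInf ?_
    rintro _ ⟨x, hx, rfl⟩
    exact hx
  let D : Set X := m '' {g | Φ g = 1}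
  have hD : D.Nonempty := ⟨_, ⊤, Φ.map_top, rfl⟩
  have hD' : DirectedOn (· ≤ ·) D := by
    rintro _ ⟨f, hf, rfl⟩ _ ⟨g, hg, rfl⟩
    refine ⟨m (f ⊓ g), ⟨f ⊓ g, ?_, rfl⟩, sInf_le ?_, sInf_le ?_⟩
    · change Φ (f ⊓ g) = 1
      rw [Φ.map_inf, show Φ f = 1 from hf, show Φ g = 1 from hg, inf_idem]
    · exact (hm (f ⊓ g)).trans inf_le_left
    · exact (hm (f ⊓ g)).trans inf_le_right
  refine ⟨sSup D, UModHom.hom_ext fun f => ?_⟩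
  change f (sSup D) = Φ f
  apply le_antisymm
  · rw [f.map_sSup D hD hD']
    refine le_of_forall_lt fun t ht => ?_
    obtain ⟨_, ⟨_, ⟨g, hg, rfl⟩, rfl⟩, hg'⟩ := lt_sSup_iff.mp ht
    -- Where `g x ≥ 1 / 2`, the point `x` is above `m g` and the right side is `1`; elsewhere the
    -- left side is `0`. Applying `Φ` makes the ramp equal to `1` at `Φ f`, so `t < Φ f`.
    have hle : UHat.ramp mid 1 mid_lt_one • g ≤ UHat.ramp t (f (m g)) hg' • f := fun x => by
      rw [smul_apply, smul_apply]
      rcases le_total (g x) mid with hx | hx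
      · rw [UHat.ramp_of_le _ hx]
        exact nonneg'
      · rw [UHat.ramp_of_ge hg' (f.mono (sInf_le hx))]
        exact le_one'
    have h1 := Φ.mono hle
    rw [UModHom.smul_apply, UModHom.smul_apply, show Φ g = 1 from hg, UHat.map_one] at h1
    by_contra hlt
    rw [UHat.ramp_of_le hg' (not_lt.mp hlt)] at h1
    exact h1.not_gt zero_lt_one
  · refine le_of_forall_lt_imp_le_of_dense fun t ht => ?_
    -- Now `Φ g = 1`, and `g` vanishes where `f` is at most `t`, so `f (m g)` cannot be below `t`.
    let g : CtsLatHom X I := UHat.ramp t (Φ f) ht • f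
    have hg : Φ g = 1 := by
      rw [UModHom.smul_apply]
      exact UHat.ramp_of_ge _ le_rfl
    refine le_trans ?_ (f.mono (le_sSup ⟨g, hg, rfl⟩ : m g ≤ sSup D))
    by_contra hlt
    have h1 := hm g
    rw [smul_apply, UHat.ramp_of_le ht (not_le.mp hlt).le] at h1
    exact h1.not_gt mid_pos

end Lattice

/-! ### The duality -/

/-- A bijective morphism of continuous lattices is an isomorphism. -/
theorem CtsLat.isIso_of_bijective {X Y : CtsLat.{u}} (f : X ⟶ Y)
    (hf : Function.Bijective (show CtsLatHom X Y from f)) : IsIso f := by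
  let f' : CtsLatHom X Y := f
  let e : X ≃ Y := Equiv.ofBijective f' hf
  have he : ∀ y, f' (e.symm y) = y := e.apply_symm_apply
  have he' : ∀ x, e.symm (f' x) = x := e.symm_apply_apply
  -- An injective map preserving binary meets reflects the order. The inverse is therefore monotone
  -- and carries directed sets to directed sets.
  have hle : ∀ x x', f' x ≤ f' x' → x ≤ x' := fun x x' h => by
    have h1 := f'.map_sInf {x, x'}
    rw [sInf_pair, Set.image_pair, sInf_pair, inf_eq_left.mpr h] at h1
    exact inf_eq_left.mp (hf.1 h1)
  have hsymm : Monotone e.symm := fun y y' h => hle _ _ (by rwa [he, he])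
  have himg : ∀ S : Set Y, f' '' (e.symm '' S) = S := fun S => by
    rw [Set.image_image]
    simp [he]
  let g : CtsLatHom Y X :=
    { toFun := e.symm
      map_sInf' := fun S => hf.1 <| by
        change f' _ = f' _
        rw [he, f'.map_sInf, himg]
      map_sSup' := fun D hD hD' => hf.1 <| by
        change f' _ = f' _
        rw [he, f'.map_sSup _ (hD.image _), himg]
        rintro _ ⟨a, ha, rfl⟩ _ ⟨b, hb, rfl⟩
        obtain ⟨c, hc, hac, hbc⟩ := hD' a ha b hb
        exact ⟨_, ⟨c, hc, rfl⟩, hsymm hac, hsymm hbc⟩ }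
  exact ⟨g, CtsLatHom.hom_ext he', CtsLatHom.hom_ext he⟩

/-- A bijective morphism of complete modules is an isomorphism. -/
theorem CompleteUMod.isIso_of_bijective {A B : CompleteUMod.{u}} (f : A ⟶ B)
    (hf : Function.Bijective (show UModHom A B from f)) : IsIso f := by
  let f' : UModHom A B := f
  let e : A ≃ B := Equiv.ofBijective f' hf
  have he : ∀ y, f' (e.symm y) = y := e.apply_symm_apply
  have he' : ∀ x, e.symm (f' x) = x := e.symm_apply_apply
  let g : UModHom B A :=
    { toFun := e.symm
      map_inf' := fun a b => hf.1 <| by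
        change f' _ = f' _
        rw [he, f'.map_inf, he, he]
      map_top' := hf.1 <| by
        change f' _ = f' _
        rw [he, f'.map_top]
      map_smul' := fun p a => hf.1 <| by
        change f' _ = f' _
        rw [he, f'.map_smul, he] }
  exact ⟨g, UModHom.hom_ext he', UModHom.hom_ext he⟩

instance isIso_evalCtsLat (X : CtsLat.{u}) : IsIso (evalCtsLat X) :=
  CtsLat.isIso_of_bijective _ ⟨CtsLatHom.eval_injective, CtsLatHom.eval_surjective⟩

instance isIso_evalUMod (A : CompleteUMod.{u}) : IsIso (evalUMod A) :=
  CompleteUMod.isIso_of_bijective _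
    ⟨CtsDuality.eval_injective A.isComplete.1, CtsDuality.eval_surjective A.isComplete⟩

/-- The dual adjunction between complete modules and continuous lattices, whose unit and counit
are the evaluation morphisms. -/
noncomputable def dualAdjunction : dualOfUMod.{u}.rightOp ⊣ dualOfCtsLat.{u} :=
  Adjunction.mkOfUnitCounit
    { unit := { app := evalUMod, naturality := fun _ _ _ => rfl }
      counit :=
        { app := fun X => (evalCtsLat X.unop).op
          naturality := fun _ _ _ => rfl }
      left_triangle := rfl
      right_triangle := rfl }

end CtsDuality

theorem mainTheorem1 :
    ∃ adj : CtsDuality.dualOfUMod.{u}.rightOp ⊣ CtsDuality.dualOfCtsLat.{u},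
      (∀ A : CtsDuality.CompleteUMod.{u}, adj.unit.app A = CtsDuality.evalUMod A) ∧
      (∀ X : CtsDuality.CtsLat.{u}, adj.counit.app (op X) = (CtsDuality.evalCtsLat X).op) ∧
      CtsDuality.dualOfUMod.{u}.rightOp.IsEquivalence ∧
      CtsDuality.dualOfCtsLat.{u}.IsEquivalence := by
  -- These two facts serve as the local instances from which `toEquivalence` makes the adjunction an
  -- equivalence.
  have hunit : ∀ A, IsIso (CtsDuality.dualAdjunction.{u}.unit.app A) := fun A =>
    CtsDuality.isIso_evalUMod A
  have hcounit : ∀ X, IsIso (CtsDuality.dualAdjunction.{u}.counit.app X) := fun X =>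
    inferInstanceAs (IsIso (CtsDuality.evalCtsLat X.unop).op)
  exact ⟨CtsDuality.dualAdjunction, fun _ => rfl, fun _ => rfl,
    CtsDuality.dualAdjunction.toEquivalence.isEquivalence_functor,
    CtsDuality.dualAdjunction.toEquivalence.isEquivalence_inverse⟩
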